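/- Let $K$ be a field and $Q=(Q_0,Q_1,s,t)$ a finite quiver. Let $R(Q)$ be the representation ring of $Q$ over $K$: the free abelian group on isomorphism classes $[V]$ of finite-dimensional representations of $Q$, modulo the relations $[V\oplus W]=[V]+[W]$, with product $[V][W]=[V\otimes W]$ induced by the pointwise tensor product. A quiver over $Q$ is a pair $(Q',f')$ with $Q'$ a finite quiver and $f'\colon Q'\to Q$ a morphism of quivers; a morphism of quivers over $Q$ is a morphism of quivers commuting with the structure maps to $Q$. The linearization $L(Q',f')$ is the representation of $Q$ with space $\bigoplus_{y\in Q'_0,\ f'(y)=x}K e_y$ at the vertex $x$, in which an arrow $\alpha\colon x\to x'$ acts by $e_y\mapsto\sum_{\beta} e_{t(\beta)}$, the sum over all $\beta\in Q'_1$ with $f'(\beta)=\alpha$ and $s(\beta)=y$. Let $\mathscr C$ be a full subcategory of the category of quivers over $Q$ such that: - for each object $x$ of $\mathscr C$ there are only finitely many objects $z$ of $\mathscr C$ having a morphism $z\to x$ (for example, $\mathscr C$ has finitely many objects); - $\mathscr C$ is acyclic: its only endomorphisms are identities, and its only invertible morphisms are identities; - each object $(Q',f')$ of $\mathscr C$ is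 connected (and non-empty), and $f'$ is a wrapping, that is, for all $i,j\in Q'_0$ it is injective on the set of arrows from $i$ to $j$; - $\mathscr C$ is closed under fiber products: the fiber product over $Q$ of any two objects of $\mathscr C$ is isomorphic over $Q$ to a finite (possibly empty) disjoint union of objects of $\mathscr C$; - $L(x)$ is indecomposable for every object $x$ of $\mathscr C$, and $L(x)\not\cong L(y)$ for distinct objects $x\neq y$ of $\mathscr C$. Write $[x,y]$ for the number of morphisms $x\to y$ in $\mathscr C$, and let $\mu$ be the Möbius function of $\mathscr C$: the integer-valued function on pairs of objects with $\mu(z,y)=0$ whenever $[z,y]=0$, and $\sum_z [x,z]\,\mu(z,y)$ equal to $1$ if $x=y$ and to $0$ otherwise. For an object $x$ put $\delta_x=\sum_z\mu(z,x)\,z$ in the free abelian group on the objects of $\mathscr C$, and extend $x \mapsto [L(x)]\in R(Q)$ to this group by $\mathbb Z$-linearity, denoting the extension again by $L$. Then: 1. The elements $L(\delta_x)$, for $x$ an object of $\mathscr C$, are pairwise orthogonal idempotents of $R(Q)$, and they form a $\mathbb Z$-basis of the subring of $R(Q)$ generated by the elements $[L(x)]$, $x$ an object of $\mathscr C$. Here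 a subring is a non-empty subset closed under subtraction and multiplication (it need not contain $1$). 2. If $(Q,\mathrm{id})$ is an object of $\mathscr C$, then $R(Q)\cong\prod_{x\in\mathscr C}\langle L(\delta_x)\rangle$ as rings, through the map $r\mapsto (r\,L(\delta_x))_{x}$, where $\langle L(\delta_x)\rangle$ is the principal ideal of $R(Q)$ generated by $L(\delta_x)$. -/

import Mathlib

open CategoryTheory
open scoped TensorProduct

universe u v w

namespace QuiverRep

/-! ### Quivers and quivers over a base quiver -/

/-- A finite quiver `(Q₀, Q₁, s, t)`. -/
structure FinQuiver : Type (u + 1) where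
  /-- vertices -/
  V : Type u
  /-- arrows -/
  A : Type u
  /-- start of an arrow -/
  s : A → V
  /-- terminal vertex of an arrow -/
  t : A → V
  [fintypeV : Fintype V]
  [fintypeA : Fintype A]

attribute [instance] FinQuiver.fintypeV FinQuiver.fintypeA

/-- A morphism of quivers. -/
@[ext]
structure FinQuiver.Hom (Q' Q : FinQuiver.{u}) : Type u where
  onV : Q'.V → Q.V
  onA : Q'.A → Q.A
  s_onA : ∀ a, Q.s (onA a) = onV (Q'.s a)
  t_onA : ∀ a, Q.t (onA a) = onV (Q'.t a)

instance : Category.{u} FinQuiver.{u} where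
  Hom := FinQuiver.Hom
  id _ := ⟨fun x => x, fun a => a, fun _ => rfl, fun _ => rfl⟩
  comp f g := ⟨fun x => g.onV (f.onV x), fun a => g.onA (f.onA a),
    fun a => by rw [g.s_onA, f.s_onA], fun a => by rw [g.t_onA, f.t_onA]⟩

/-- The category of quivers over `Q`: objects are quivers `Q'` with a structure map `Q' ⟶ Q`,
morphisms are morphisms of quivers commuting with the structure maps. -/
abbrev QuiverOver (Q : FinQuiver.{u}) : Type (u + 1) := Over Q

/-- The quiver underlying a quiver over `Q`. -/
abbrev QuiverOver.dom {Q : FinQuiver.{u}} (X : QuiverOver Q) : FinQuiver.{u} := X.left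

/-- The structure map of a quiver over `Q`. -/
abbrev QuiverOver.str {Q : FinQuiver.{u}} (X : QuiverOver Q) : FinQuiver.Hom X.dom Q := X.hom

/-- A quiver is connected if it is nonempty and its underlying undirected graph is connected. -/
def FinQuiver.IsConnected (Q : FinQuiver.{u}) : Prop :=
  Nonempty Q.V ∧
    ∀ x y : Q.V, Relation.EqvGen (fun a b => ∃ α : Q.A, Q.s α = a ∧ Q.t α = b) x y

/-- A wrapping: a morphism of quivers which is injective on the set of arrows from `i` to `j`,
for all vertices `i`, `j`. -/
def FinQuiver.Hom.IsWrapping {Q' Q : FinQuiver.{u}} (f : FinQuiver.Hom Q' Q) : Prop :=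
  ∀ i j : Q'.V, Set.InjOn f.onA {α | Q'.s α = i ∧ Q'.t α = j}

open scoped Classical in
/-- The fiber product of two quivers over `Q`. -/
noncomputable def fiberProduct {Q : FinQuiver.{u}} (X Y : QuiverOver Q) : QuiverOver Q :=
  Over.mk (Y := ({
    V := {p : X.dom.V × Y.dom.V // X.str.onV p.1 = Y.str.onV p.2}
    A := {p : X.dom.A × Y.dom.A // X.str.onA p.1 = Y.str.onA p.2}
    s := fun a => ⟨(X.dom.s a.1.1, Y.dom.s a.1.2), by
      rw [← X.str.s_onA, ← Y.str.s_onA, a.2]⟩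
    t := fun a => ⟨(X.dom.t a.1.1, Y.dom.t a.1.2), by
      rw [← X.str.t_onA, ← Y.str.t_onA, a.2]⟩ } : FinQuiver.{u}))
    (show FinQuiver.Hom _ _ from
      { onV := fun p => X.str.onV p.1.1
        onA := fun p => X.str.onA p.1.1
        s_onA := fun a => X.str.s_onA a.1.1
        t_onA := fun a => X.str.t_onA a.1.1 })

/-- The disjoint union of finitely many quivers over `Q` (empty if `n = 0`). -/
def disjointUnion {Q : FinQuiver.{u}} {n : ℕ} (X : Fin n → QuiverOver Q) : QuiverOver Q :=
  Over.mk (Y := ({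
    V := Σ i, (X i).dom.V
    A := Σ i, (X i).dom.A
    s := fun a => ⟨a.1, (X a.1).dom.s a.2⟩
    t := fun a => ⟨a.1, (X a.1).dom.t a.2⟩ } : FinQuiver.{u}))
    (show FinQuiver.Hom _ _ from
      { onV := fun x => (X x.1).str.onV x.2
        onA := fun a => (X a.1).str.onA a.2
        s_onA := fun a => (X a.1).str.s_onA a.2
        t_onA := fun a => (X a.1).str.t_onA a.2 })

/-- A collection of quivers over `Q` is closed under fiber products if the fiber product of any
two members is (isomorphic over `Q` to) a disjoint union of members. -/
def ClosedUnderFiberProducts {Q : FinQuiver.{u}} (C : ObjectProperty (QuiverOver Q)) : Prop :=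
  ∀ X Y : QuiverOver Q, C X → C Y →
    ∃ (n : ℕ) (W : Fin n → QuiverOver Q), (∀ i, C (W i)) ∧
      Nonempty (fiberProduct X Y ≅ disjointUnion W)

/-! ### Representations and the representation ring -/

/-- A (finite dimensional) representation of the quiver `Q` over the field `K`. -/
structure QRep (K : Type u) [Field K] (Q : FinQuiver.{u}) : Type (u + 1) where
  space : Q.V → Type u
  [addCommGroup : ∀ x, AddCommGroup (space x)]
  [module : ∀ x, Module K (space x)]
  [finite : ∀ x, FiniteDimensional K (space x)]
  map : ∀ α : Q.A, space (Q.s α) →ₗ[K] space (Q.t α)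

attribute [instance] QRep.addCommGroup QRep.module QRep.finite

namespace QRep

variable {K : Type u} [Field K] {Q Q' : FinQuiver.{u}}

/-- An isomorphism of representations. -/
structure Iso (V W : QRep K Q) : Type u where
  equiv : ∀ x, V.space x ≃ₗ[K] W.space x
  comm : ∀ (α : Q.A) (v : V.space (Q.s α)),
    equiv (Q.t α) (V.map α v) = W.map α (equiv (Q.s α) v)

/-- The direct sum of two representations. -/
abbrev directSum (V W : QRep K Q) : QRep K Q where
  space x := V.space x × W.space x
  map α := (V.map α).prodMap (W.map α)

/-- The (pointwise) tensor product of two representations. -/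
noncomputable abbrev tensor (V W : QRep K Q) : QRep K Q where
  space x := V.space x ⊗[K] W.space x
  map α := TensorProduct.map (V.map α) (W.map α)

variable (K Q) in
/-- The identity representation: `K` at each vertex and the identity over each arrow. -/
abbrev one : QRep K Q where
  space _ := K
  map _ := LinearMap.id

/-- The zero representation(s). -/
def IsZero (V : QRep K Q) : Prop := ∀ x, Subsingleton (V.space x)

/-- Indecomposable representations. -/
def IsIndecomposable (V : QRep K Q) : Prop :=
  ¬ V.IsZero ∧ ∀ U W : QRep K Q, Nonempty (V.Iso (U.directSum W)) → U.IsZero ∨ W.IsZero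

open scoped Classical in
/-- The pushforward `f_* V` of a representation along a morphism of quivers: its space at `x` is
`⨁_{f y = x} V_y`, and its map over `α` is `∑_{f β = α} φ_β`, where each `φ_β` is extended by
zero. -/
noncomputable abbrev pushforward (f : FinQuiver.Hom Q' Q) (V : QRep K Q') : QRep K Q where
  space x := (y : {y : Q'.V // f.onV y = x}) → V.space y.1
  map α := ∑ β : {β : Q'.A // f.onA β = α},
    (LinearMap.single K (fun y : {y : Q'.V // f.onV y = Q.t α} => V.space y.1)
        ⟨Q'.t β.1, by rw [← f.t_onA, β.2]⟩) ∘ₗ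
      V.map β.1 ∘ₗ
      (LinearMap.proj (φ := fun y : {y : Q'.V // f.onV y = Q.s α} => V.space y.1)
        ⟨Q'.s β.1, by rw [← f.s_onA, β.2]⟩)

variable (K) in
/-- The linearization `L(Q', f') = f'_* 𝟙` of a quiver over `Q`. -/
noncomputable abbrev linearization (X : QuiverOver Q) : QRep K Q :=
  pushforward X.str (one K X.dom)

/-! Isomorphism is an equivalence relation compatible with the operations. -/

namespace Iso

def refl (V : QRep K Q) : V.Iso V := ⟨fun _ => LinearEquiv.refl K _, fun _ _ => rfl⟩

def symm {V W : QRep K Q} (e : V.Iso W) : W.Iso V :=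
  ⟨fun x => (e.equiv x).symm, fun α v => by
    rw [LinearEquiv.symm_apply_eq, e.comm, LinearEquiv.apply_symm_apply]⟩

def trans {U V W : QRep K Q} (e : U.Iso V) (f : V.Iso W) : U.Iso W :=
  ⟨fun x => (e.equiv x).trans (f.equiv x), fun α v => by
    simp only [LinearEquiv.trans_apply, e.comm, f.comm]⟩

noncomputable def tensorCongr {V V' W W' : QRep K Q} (e : V.Iso V') (f : W.Iso W') :
    (V.tensor W).Iso (V'.tensor W') :=
  ⟨fun x => TensorProduct.congr (e.equiv x) (f.equiv x), fun α => LinearMap.congr_fun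
    (show (TensorProduct.congr (e.equiv (Q.t α)) (f.equiv (Q.t α))).toLinearMap ∘ₗ
        TensorProduct.map (V.map α) (W.map α) =
        TensorProduct.map (V'.map α) (W'.map α) ∘ₗ
        (TensorProduct.congr (e.equiv (Q.s α)) (f.equiv (Q.s α))).toLinearMap from
      TensorProduct.ext' fun a b => by simp [e.comm, f.comm])⟩

noncomputable def tensorAssoc (U V W : QRep K Q) :
    ((U.tensor V).tensor W).Iso (U.tensor (V.tensor W)) :=
  ⟨fun x => TensorProduct.assoc K (U.space x) (V.space x) (W.space x), fun α v =>
    LinearMap.congr_fun (TensorProduct.map_map_comp_assoc_eq (U.map α) (V.map α) (W.map α)).symm v⟩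

noncomputable def tensorComm (V W : QRep K Q) : (V.tensor W).Iso (W.tensor V) :=
  ⟨fun x => TensorProduct.comm K (V.space x) (W.space x), fun α v =>
    (TensorProduct.map_comm (W.map α) (V.map α) v).symm⟩

noncomputable def oneTensor (V : QRep K Q) : ((one K Q).tensor V).Iso V :=
  ⟨fun x => TensorProduct.lid K (V.space x), fun α => LinearMap.congr_fun
    (show (TensorProduct.lid K (V.space (Q.t α))).toLinearMap ∘ₗ
        TensorProduct.map LinearMap.id (V.map α) =
        V.map α ∘ₗ (TensorProduct.lid K (V.space (Q.s α))).toLinearMap from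
      TensorProduct.ext' fun a b => by simp)⟩

noncomputable def tensorDirectSum (U V W : QRep K Q) :
    (U.tensor (V.directSum W)).Iso ((U.tensor V).directSum (U.tensor W)) :=
  ⟨fun x => TensorProduct.prodRight K K (U.space x) (V.space x) (W.space x),
    fun α => LinearMap.congr_fun
    (show (TensorProduct.prodRight K K (U.space (Q.t α)) (V.space (Q.t α))
          (W.space (Q.t α))).toLinearMap ∘ₗ
        TensorProduct.map (U.map α) ((V.map α).prodMap (W.map α)) =
        ((TensorProduct.map (U.map α) (V.map α)).prodMap
          (TensorProduct.map (U.map α) (W.map α))) ∘ₗ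
        (TensorProduct.prodRight K K (U.space (Q.s α)) (V.space (Q.s α))
          (W.space (Q.s α))).toLinearMap from
      TensorProduct.ext' fun a b => by simp)⟩

end Iso

end QRep

section RepRing

variable (K : Type u) [Field K] (Q : FinQuiver.{u})

/-- Isomorphism of representations as a setoid. -/
instance repSetoid : Setoid (QRep K Q) where
  r V W := Nonempty (V.Iso W)
  iseqv := ⟨fun V => ⟨QRep.Iso.refl V⟩, fun ⟨e⟩ => ⟨e.symm⟩, fun ⟨e⟩ ⟨f⟩ => ⟨e.trans f⟩⟩

/-- Isomorphism classes of representations of `Q` over `K`. -/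
def IsoClass : Type (u + 1) := Quotient (repSetoid K Q)

variable {K Q} in
/-- The isomorphism class of a representation. -/
def IsoClass.mk (V : QRep K Q) : IsoClass K Q := Quotient.mk (repSetoid K Q) V

/-- Isomorphism classes form a commutative monoid under the tensor product. -/
noncomputable instance : CommMonoid (IsoClass K Q) where
  mul := Quotient.map₂ QRep.tensor fun _ _ ⟨e⟩ _ _ ⟨f⟩ => ⟨e.tensorCongr f⟩
  one := IsoClass.mk (QRep.one K Q)
  mul_assoc a b c := by
    refine Quotient.inductionOn₃ a b c fun U V W => ?_
    exact Quotient.sound ⟨QRep.Iso.tensorAssoc U V W⟩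
  mul_comm a b := by
    refine Quotient.inductionOn₂ a b fun V W => ?_
    exact Quotient.sound ⟨QRep.Iso.tensorComm V W⟩
  one_mul a := by
    refine Quotient.inductionOn a fun V => ?_
    exact Quotient.sound ⟨QRep.Iso.oneTensor V⟩
  mul_one a := by
    refine Quotient.inductionOn a fun V => ?_
    exact Quotient.sound ⟨(QRep.Iso.tensorComm V _).trans (QRep.Iso.oneTensor V)⟩

/-- The subgroup of the free abelian group on isomorphism classes of representations that is
generated by all `[V ⊕ W] - [V] - [W]`. -/
noncomputable def relSubgroup : AddSubgroup (FreeAbelianGroup (IsoClass K Q)) :=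
  AddSubgroup.closure {r | ∃ V W : QRep K Q,
    r = FreeAbelianGroup.of (IsoClass.mk (V.directSum W))
      - FreeAbelianGroup.of (IsoClass.mk V) - FreeAbelianGroup.of (IsoClass.mk W)}

/-- The subgroup `relSubgroup K Q` is an ideal for the multiplication `[V] * [W] = [V ⊗ W]`. -/
noncomputable def relIdeal : Ideal (FreeAbelianGroup (IsoClass K Q)) where
  carrier := relSubgroup K Q
  add_mem' := (relSubgroup K Q).add_mem
  zero_mem' := (relSubgroup K Q).zero_mem
  smul_mem' c x hx := by
    change c * x ∈ relSubgroup K Q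
    induction c using FreeAbelianGroup.induction_on with
    | zero => rw [zero_mul]; exact (relSubgroup K Q).zero_mem
    | neg a ha => rw [neg_mul]; exact (relSubgroup K Q).neg_mem ha
    | add a b ha hb => rw [add_mul]; exact (relSubgroup K Q).add_mem ha hb
    | of a =>
      obtain ⟨U, rfl⟩ : ∃ U, a = IsoClass.mk U := ⟨a.out, (Quotient.out_eq a).symm⟩
      refine AddSubgroup.closure_induction (p := fun x _ =>
        FreeAbelianGroup.of (IsoClass.mk U) * x ∈ relSubgroup K Q) ?_ ?_ ?_ ?_ hx
      · rintro _ ⟨V, W, rfl⟩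
        refine AddSubgroup.subset_closure ⟨U.tensor V, U.tensor W, ?_⟩
        rw [mul_sub, mul_sub, ← FreeAbelianGroup.of_mul, ← FreeAbelianGroup.of_mul,
          ← FreeAbelianGroup.of_mul]
        have h : IsoClass.mk U * IsoClass.mk (V.directSum W)
            = IsoClass.mk ((U.tensor V).directSum (U.tensor W)) :=
          Quotient.sound ⟨QRep.Iso.tensorDirectSum U V W⟩
        rw [h]
        rfl
      · rw [mul_zero]; exact (relSubgroup K Q).zero_mem
      · intro x y _ _ h₁ h₂
        rw [mul_add]; exact (relSubgroup K Q).add_mem h₁ h₂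
      · intro x _ h
        rw [mul_neg]; exact (relSubgroup K Q).neg_mem h

/-- The representation ring `R(Q)`: the free abelian group on isomorphism classes of
representations modulo the relations `[V ⊕ W] = [V] + [W]`, with product `[V] * [W] = [V ⊗ W]`. -/
abbrev RepRing : Type (u + 1) := FreeAbelianGroup (IsoClass K Q) ⧸ relIdeal K Q

variable {K Q} in
/-- The element `[V]` of the representation ring. -/
noncomputable def RepRing.of (V : QRep K Q) : RepRing K Q :=
  Ideal.Quotient.mk (relIdeal K Q) (FreeAbelianGroup.of (IsoClass.mk V))

end RepRing

/-! ### Acyclic categories and the Möbius function -/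

section Mobius

variable (D : Type w) [Category.{v} D]

/-- A category is acyclic if the only endomorphisms are identities and only identities are
invertible. -/
def IsAcyclicCategory : Prop :=
  (∀ (x : D) (f : x ⟶ x), f = 𝟙 x) ∧ ∀ (x y : D) (f : x ⟶ y), IsIso f → x = y

/-- Each object receives morphisms from only finitely many objects. This holds in particular if
the category has finitely many objects. -/
class LowerFinite : Prop where
  finite : ∀ y : D, Finite {x : D // Nonempty (x ⟶ y)}

variable {D}

/-- The objects having a morphism to `y`. -/
abbrev Below (y : D) : Type w := {x : D // Nonempty (x ⟶ y)}

noncomputable instance [LowerFinite D] (y : D) : Fintype (Below y) :=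
  @Fintype.ofFinite _ (LowerFinite.finite y)

/-- The Hom matrix of the full subcategory of objects having a morphism to `y`. -/
noncomputable def homMatrix (y : D) : Matrix (Below y) (Below y) ℤ :=
  Matrix.of fun a b => (Nat.card (a.1 ⟶ b.1) : ℤ)

open scoped Classical in
/-- The Möbius function. Its value `μ(x, y)` is the `(x, y)` entry of the inverse of the Hom matrix
if `x` has a morphism to `y`, and `0` otherwise. Only the objects having a morphism to `y` matter
for `μ(·, y)`, so the Hom matrix is restricted to these objects, which makes it a finite matrix;
if the category is finite this is the same as inverting the full Hom matrix. -/
noncomputable def mobius [LowerFinite D] (x y : D) : ℤ :=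
  if h : Nonempty (x ⟶ y) then (homMatrix y)⁻¹ ⟨x, h⟩ ⟨y, ⟨𝟙 y⟩⟩ else 0

/-- The element `δ_x = ∑_z μ(z, x) z` of the free abelian group on the objects (the additive group
of the Möbius ring). The summands with no morphism `z ⟶ x` vanish. -/
noncomputable def delta [LowerFinite D] (x : D) : D →₀ ℤ :=
  ∑ z : Below x, Finsupp.single z.1 (mobius z.1 x)

end Mobius

/-- The `ℤ`-linear extension of `X ↦ [L(X)]` to the free abelian group on the objects of the full
subcategory `C` of the category of quivers over `Q`. -/
noncomputable def linearizationMap (K : Type u) [Field K] {Q : FinQuiver.{u}}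
    (C : ObjectProperty (QuiverOver Q)) : (C.FullSubcategory →₀ ℤ) →ₗ[ℤ] RepRing K Q :=
  Finsupp.linearCombination ℤ fun X : C.FullSubcategory =>
    RepRing.of (QRep.linearization K X.obj)

end QuiverRep

open QuiverRep


/-!
Sending an object `x` to the function `w ↦ [w, x]` (its marks) embeds the free abelian group on the
objects of `C` into the ring of integer valued functions on the objects, and `δ_x` goes to the
indicator function of `x`. Since the objects `w` are connected, the marks of a fiber product of two
objects, computed through its decomposition into objects, are the products of the marks; the same
decomposition computes the product of the two linearizations in `R(Q)`. Hence any product relation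
between marks also holds between linearizations, and the relations `1_x 1_y = δ_{xy} 1_x` between
indicator functions show that the `L(δ_x)` are orthogonal idempotents.

By Fitting's lemma an indecomposable representation has a local endomorphism ring, so its
multiplicity as a summand is an additive invariant of representations. The multiplicities separate
the `L(x)`, whose classes are therefore linearly independent: `L` is injective, and it carries the
basis `(δ_x)_x` to a basis of the subring.

If the base quiver is an object then it is terminal, so that its marks are all equal to `1`: it is
the sum of the `δ_x`. As `L` sends it to `1`, the idempotents `L(δ_x)` are complete.
-/

namespace QuiverRep

section Idempotents

theorem mul_mem_range_of_single {k ι R : Type*} [CommSemiring k] [NonUnitalNonAssocSemiring R]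
    [Module k R] [IsScalarTower k R R] [SMulCommClass k R R] {l : (ι →₀ k) →ₗ[k] R}
    (hl : ∀ i j, l (.single i 1) * l (.single j 1) ∈ l.range) (a b : ι →₀ k) :
    l a * l b ∈ l.range := by
  induction a using Finsupp.induction_linear with
  | zero => simp
  | add a₁ a₂ h₁ h₂ => simpa only [map_add, add_mul] using add_mem h₁ h₂
  | single i m =>
    induction b using Finsupp.induction_linear with
    | zero => simp
    | add b₁ b₂ h₁ h₂ => simpa only [map_add, mul_add] using add_mem h₁ h₂
    | single j n =>
      rw [← Finsupp.smul_single_one i m, ← Finsupp.smul_single_one j n, map_smul, map_smul,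
        smul_mul_smul_comm]
      exact Submodule.smul_mem _ _ (hl i j)

theorem mem_closure_range_single_iff {ι R : Type*} [NonUnitalRing R] {l : (ι →₀ ℤ) →ₗ[ℤ] R}
    (hl : ∀ i j, l (.single i 1) * l (.single j 1) ∈ l.range) {r : R} :
    r ∈ NonUnitalSubring.closure (Set.range fun i => l (.single i 1)) ↔ r ∈ l.range := by
  constructor
  · intro hr
    induction hr using NonUnitalSubring.closure_induction with
    | mem r hr => exact hr.imp' (Finsupp.single · 1) fun _ => id
    | zero => exact zero_mem _
    | add r s _ _ hr hs => exact add_mem hr hs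
    | neg r _ hr => exact neg_mem hr
    | mul r s _ _ hr hs =>
      obtain ⟨⟨a, rfl⟩, ⟨b, rfl⟩⟩ := And.intro hr hs
      exact mul_mem_range_of_single hl a b
  · rintro ⟨a, rfl⟩
    induction a using Finsupp.induction_linear with
    | zero => exact (map_zero l).symm ▸ zero_mem _
    | add a b ha hb => exact (map_add l a b).symm ▸ add_mem ha hb
    | single i n =>
      rw [← Finsupp.smul_single_one, map_smul]
      exact zsmul_mem (NonUnitalSubring.subset_closure (Set.mem_range_self i)) n

theorem exists_basis_closure_range_single {ι κ R : Type*} [NonUnitalRing R]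
    {l : (ι →₀ ℤ) →ₗ[ℤ] R} (hl : ∀ i j, l (.single i 1) * l (.single j 1) ∈ l.range)
    (hinj : Function.Injective l) (b : Module.Basis κ ℤ (ι →₀ ℤ)) :
    ∃ b' : Module.Basis κ ℤ (NonUnitalSubring.closure (Set.range fun i => l (.single i 1))),
      ∀ k, (b' k : R) = l (b k) := by
  let l' : (ι →₀ ℤ) →+ NonUnitalSubring.closure (Set.range fun i => l (.single i 1)) :=
    { toFun := fun a => ⟨l a, (mem_closure_range_single_iff hl).2 ⟨a, rfl⟩⟩
      map_zero' := Subtype.ext (map_zero l)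
      map_add' := fun a b => Subtype.ext (map_add l a b) }
  have hl' : Function.Bijective l' :=
    ⟨fun a b hab => hinj (congrArg Subtype.val hab), fun ⟨r, hr⟩ =>
      ((mem_closure_range_single_iff hl).1 hr).imp fun _ => Subtype.ext⟩
  exact ⟨b.map (AddEquiv.ofBijective l' hl').toIntLinearEquiv, fun _ => rfl⟩

theorem orthogonalIdempotents_of_mul_mem_range_prod {k A B R ι : Type*} [CommSemiring k]
    [AddCommMonoid A] [Semiring B] [Semiring R] [Module k A] [Module k B] [Module k R]
    {m : A →ₗ[k] B} {l : A →ₗ[k] R} (hm : Function.Injective m)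
    (hl : ∀ a b, m.prod l a * m.prod l b ∈ (m.prod l).range) {e : ι → A}
    (he : OrthogonalIdempotents fun i => m (e i)) : OrthogonalIdempotents fun i => l (e i) := by
  have lift_mul {a b c : A} (hab : m a * m b = m c) : l a * l b = l c := by
    obtain ⟨c', hc'⟩ := hl a b
    obtain ⟨hmc, hlc⟩ := Prod.ext_iff.1 hc'
    obtain rfl : c' = c := hm (hmc.trans hab)
    exact hlc.symm
  exact ⟨fun i => lift_mul (he.idem i), fun i j hij =>
    (lift_mul ((he.ortho hij).trans (map_zero m).symm)).trans (map_zero l)⟩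

theorem mul_eq_self_of_mem_span_singleton {R : Type*} [CommSemiring R] {e x : R}
    (he : IsIdempotentElem e) (hx : x ∈ Ideal.span {e}) : x * e = x := by
  obtain ⟨a, rfl⟩ := Ideal.mem_span_singleton'.1 hx
  rw [mul_assoc, he.eq]

/-- The decomposition of a commutative ring into the ideals generated by the members of a complete
family of orthogonal idempotents. These ideals are the corners of
`CompleteOrthogonalIdempotents.ringEquivOfComm`. -/
def ringEquivPiSpan {R ι : Type*} [CommRing R] [Fintype ι] {e : ι → R}
    (he : CompleteOrthogonalIdempotents e) : R ≃+* ∀ i, (Ideal.span {e i} : Ideal R) where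
  toFun r i := ⟨r * e i, Ideal.mem_span_singleton'.2 ⟨r, rfl⟩⟩
  invFun x := ∑ i, (x i : R)
  left_inv r := by simp only [← Finset.mul_sum, he.complete, mul_one]
  right_inv x := funext fun i => Subtype.ext <| by
    have mul_e (j : ι) : (x j : R) * e j = x j :=
      mul_eq_self_of_mem_span_singleton (he.idem j) (x j).2
    dsimp only
    rw [Finset.sum_mul, Finset.sum_eq_single_of_mem i (Finset.mem_univ i) fun j _ hji => ?_, mul_e]
    rw [← mul_e, mul_assoc, he.ortho hji, mul_zero]
  map_mul' r s := funext fun i => Subtype.ext <| by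
    change r * s * e i = r * e i * (s * e i)
    rw [mul_mul_mul_comm, (he.idem i).eq]
  map_add' r s := funext fun i => Subtype.ext (add_mul r s (e i))

end Idempotents

section MoebiusInversion

variable {D : Type w} [Category.{v} D]

namespace IsAcyclicCategory

theorem card_end (h : IsAcyclicCategory D) (x : D) : Nat.card (x ⟶ x) = 1 :=
  Nat.card_eq_one_iff_unique.2 ⟨⟨fun f g => (h.1 x f).trans (h.1 x g).symm⟩, ⟨𝟙 x⟩⟩

/-- The objects of an acyclic category, ordered by the existence of morphisms. -/
abbrev partialOrder (h : IsAcyclicCategory D) : PartialOrder D where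
  le x y := Nonempty (x ⟶ y)
  le_refl x := ⟨𝟙 x⟩
  le_trans _ _ _ := fun ⟨f⟩ ⟨g⟩ => ⟨f ≫ g⟩
  le_antisymm x y := fun ⟨f⟩ ⟨g⟩ => h.2 x y f ⟨g, h.1 x _, h.1 y _⟩

theorem exists_linearOrder (h : IsAcyclicCategory D) :
    ∃ _ : LinearOrder D, ∀ x y : D, Nonempty (x ⟶ y) → x ≤ y := by
  let po : PartialOrder D := h.partialOrder
  exact ⟨show LinearOrder (LinearExtension D) from inferInstance, fun x y hxy =>
    (toLinearExtension (α := D)).monotone (show po.le x y from hxy)⟩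

end IsAcyclicCategory

theorem card_hom_eq_zero {x y : D} (h : ¬ Nonempty (x ⟶ y)) : Nat.card (x ⟶ y) = 0 :=
  have := not_nonempty_iff.1 h
  Nat.card_of_isEmpty

theorem det_homMatrix [LowerFinite D] (h : IsAcyclicCategory D) (y : D)
    [DecidableEq (Below y)] : (homMatrix y).det = 1 := by
  obtain ⟨_, hmono⟩ := h.exists_linearOrder
  have htri : (homMatrix y).IsUpperTriangular := fun a b hab =>
    congrArg Nat.cast (card_hom_eq_zero fun hf => (hmono a.1 b.1 hf).not_gt hab)
  convert Matrix.det_of_isUpperTriangular htri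
  simp only [homMatrix, Matrix.of_apply, h.card_end, Nat.cast_one, Finset.prod_const_one]

theorem sum_card_hom_mul_mobius [LowerFinite D] [DecidableEq D] (h : IsAcyclicCategory D)
    (x y : D) :
    ∑ z : Below y, (Nat.card (x ⟶ z.1) : ℤ) * mobius z.1 y = if x = y then 1 else 0 := by
  classical
  by_cases hxy : Nonempty (x ⟶ y)
  · have hinv : homMatrix y * (homMatrix y)⁻¹ = 1 :=
      Matrix.mul_nonsing_inv _ (by rw [det_homMatrix h]; exact isUnit_one)
    have hentry := congr_fun₂ hinv ⟨x, hxy⟩ ⟨y, ⟨𝟙 y⟩⟩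
    simp only [Matrix.mul_apply, Matrix.one_apply, Subtype.mk.injEq] at hentry
    rw [← hentry]
    exact Finset.sum_congr rfl fun z _ => by rw [mobius, dif_pos z.2]; convert rfl; rfl
  · rw [if_neg (by rintro rfl; exact hxy ⟨𝟙 x⟩)]
    refine Finset.sum_eq_zero fun z _ => ?_
    rw [card_hom_eq_zero fun ⟨f⟩ => hxy (z.2.map (f ≫ ·)), Nat.cast_zero, zero_mul]

variable (D) in
/-- The table of marks: the homomorphism from the free abelian group on the objects to the
functions on the objects which sends `x` to `w ↦ [w, x]`. -/
noncomputable def marks : (D →₀ ℤ) →ₗ[ℤ] (D → ℤ) :=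
  Finsupp.linearCombination ℤ fun x w => (Nat.card (w ⟶ x) : ℤ)

theorem marks_single_apply (x w : D) (n : ℤ) :
    marks D (.single x n) w = n * Nat.card (w ⟶ x) := by
  simp [marks]

theorem marks_delta [LowerFinite D] [DecidableEq D] (h : IsAcyclicCategory D) (x : D) :
    marks D (delta x) = Pi.single x 1 := by
  ext w
  rw [Pi.single_apply, ← sum_card_hom_mul_mobius h, delta, map_sum, Finset.sum_apply]
  exact Finset.sum_congr rfl fun z _ => by rw [marks_single_apply, mul_comm]

theorem marks_injective (h : IsAcyclicCategory D) : Function.Injective (marks D) := by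
  refine (injective_iff_map_eq_zero _).2 fun a ha => by_contra fun hne => ?_
  let : PartialOrder D := h.partialOrder
  obtain ⟨m, hm⟩ := a.support.exists_maximal (Finsupp.support_nonempty_iff.2 hne)
  have hmark : marks D a m = a m := by
    rw [marks, Finsupp.linearCombination_apply, Finsupp.sum, Finset.sum_apply,
      Finset.sum_eq_single_of_mem m hm.1]
    · simp [h.card_end]
    · intro x hx hxm
      simp [card_hom_eq_zero fun hf => hxm (hm.eq_of_ge hx hf)]
  exact Finsupp.mem_support_iff.1 hm.1 (hmark.symm.trans (congrFun ha m))

theorem single_eq_sum_delta [LowerFinite D] (h : IsAcyclicCategory D) (x : D) :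
    Finsupp.single x (1 : ℤ) = ∑ z : Below x, (Nat.card (z.1 ⟶ x) : ℤ) • delta z.1 := by
  classical
  refine marks_injective h (funext fun w => ?_)
  simp only [map_sum, map_smul, marks_delta h, marks_single_apply, Finset.sum_apply,
    Pi.smul_apply, Pi.single_apply, smul_eq_mul, one_mul, mul_ite, mul_one, mul_zero]
  by_cases hw : Nonempty (w ⟶ x)
  · rw [Finset.sum_eq_single_of_mem ⟨w, hw⟩ (Finset.mem_univ _), if_pos rfl]
    exact fun z _ hz => if_neg fun hwz => hz (Subtype.ext hwz.symm)
  · rw [card_hom_eq_zero hw, Finset.sum_eq_zero fun z _ => if_neg _, Nat.cast_zero]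
    rintro z - rfl
    exact hw z.2

/-- The basis `(δ_x)_x` of the free abelian group on the objects. -/
noncomputable def deltaBasis [LowerFinite D] (h : IsAcyclicCategory D) :
    Module.Basis D ℤ (D →₀ ℤ) :=
  Module.Basis.mk (v := delta)
    (by
      classical
      refine LinearIndependent.of_comp (marks D) ?_
      simpa only [Function.comp_def, marks_delta h] using Pi.linearIndependent_single_one D ℤ)
    (by
      rw [← Finsupp.basisSingleOne.span_eq, Finsupp.coe_basisSingleOne, Submodule.span_le]
      rintro _ ⟨x, rfl⟩
      change Finsupp.single x 1 ∈ Submodule.span ℤ _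
      rw [single_eq_sum_delta h]
      exact sum_mem fun z _ => Submodule.smul_mem _ _ (Submodule.subset_span ⟨z.1, rfl⟩))

theorem deltaBasis_apply [LowerFinite D] (h : IsAcyclicCategory D) (x : D) :
    deltaBasis h x = delta x :=
  Module.Basis.mk_apply _ _ x

theorem sum_delta_of_isTerminal [LowerFinite D] [Fintype D] (h : IsAcyclicCategory D) {t : D}
    (ht : Limits.IsTerminal t) : ∑ x : D, delta x = Finsupp.single t 1 := by
  classical
  refine marks_injective h (funext fun w => ?_)
  have : Nat.card (w ⟶ t) = 1 := Nat.card_eq_one_iff_unique.2 ⟨⟨ht.hom_ext⟩, ⟨ht.from w⟩⟩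
  simp [marks_delta h, marks_single_apply, this]

theorem finite_of_isTerminal [LowerFinite D] {t : D} (ht : Limits.IsTerminal t) : Finite D :=
  have := LowerFinite.finite t
  Finite.of_injective (fun x => (⟨x, ⟨ht.from x⟩⟩ : Below t)) fun _ _ => congrArg Subtype.val

theorem orthogonalIdempotents_delta [LowerFinite D] (h : IsAcyclicCategory D) {R : Type*} [Ring R]
    {l : (D →₀ ℤ) →ₗ[ℤ] R}
    (hl : ∀ x y, (marks D).prod l (.single x 1) * (marks D).prod l (.single y 1) ∈
      ((marks D).prod l).range) :
    OrthogonalIdempotents fun x => l (delta x) := by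
  classical
  refine orthogonalIdempotents_of_mul_mem_range_prod (marks_injective h)
    (mul_mem_range_of_single hl) ?_
  simp only [marks_delta h]
  refine ⟨fun x => ?_, fun x y hxy => ?_⟩
  · rw [IsIdempotentElem, ← Pi.single_mul, one_mul]
  · ext w
    rcases eq_or_ne w x with rfl | hwx
    · simp [hxy]
    · simp [hwx]

end MoebiusInversion

section CountingMorphisms

theorem FinQuiver.hom_ext {X Y : FinQuiver.{u}} {f g : X ⟶ Y}
    (hV : ∀ x, FinQuiver.Hom.onV f x = FinQuiver.Hom.onV g x)
    (hA : ∀ a, FinQuiver.Hom.onA f a = FinQuiver.Hom.onA g a) : f = g :=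
  FinQuiver.Hom.ext (funext hV) (funext hA)

instance (X Y : FinQuiver.{u}) : Finite (X ⟶ Y) :=
  Finite.of_injective (fun f => (FinQuiver.Hom.onV f, FinQuiver.Hom.onA f)) fun _ _ h =>
    FinQuiver.Hom.ext (congrArg Prod.fst h) (congrArg Prod.snd h)

theorem FinQuiver.IsConnected.eq_of_forall_arrow {X : FinQuiver.{u}} (hX : X.IsConnected)
    {T : Type*} {c : X.V → T} (hc : ∀ a, c (X.s a) = c (X.t a)) (x y : X.V) : c x = c y := by
  induction hX.2 x y with
  | rel x y h =>
    obtain ⟨a, rfl, rfl⟩ := h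
    exact hc a
  | refl x => rfl
  | symm x y _ h => exact h.symm
  | trans x y z _ _ h₁ h₂ => exact h₁.trans h₂

namespace QuiverOver

variable {Q : FinQuiver.{u}} {W X Y : QuiverOver Q}

/-- The map on vertices underlying a morphism of quivers over `Q`. -/
abbrev onV (f : X ⟶ Y) : X.dom.V → Y.dom.V :=
  FinQuiver.Hom.onV f.left

/-- The map on arrows underlying a morphism of quivers over `Q`. -/
abbrev onA (f : X ⟶ Y) : X.dom.A → Y.dom.A :=
  FinQuiver.Hom.onA f.left

theorem str_onV (f : X ⟶ Y) (x : X.dom.V) : Y.str.onV (onV f x) = X.str.onV x :=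
  congrArg (FinQuiver.Hom.onV · x) (Over.w f)

theorem str_onA (f : X ⟶ Y) (a : X.dom.A) : Y.str.onA (onA f a) = X.str.onA a :=
  congrArg (FinQuiver.Hom.onA · a) (Over.w f)

theorem s_onA (f : X ⟶ Y) (a : X.dom.A) : Y.dom.s (onA f a) = onV f (X.dom.s a) :=
  FinQuiver.Hom.s_onA f.left a

theorem t_onA (f : X ⟶ Y) (a : X.dom.A) : Y.dom.t (onA f a) = onV f (X.dom.t a) :=
  FinQuiver.Hom.t_onA f.left a

theorem hom_ext {f g : X ⟶ Y} (hV : ∀ x, onV f x = onV g x) (hA : ∀ a, onA f a = onA g a) :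
    f = g :=
  Over.OverMorphism.ext (FinQuiver.hom_ext hV hA)

/-- The morphism of quivers over `Q` with prescribed maps on vertices and arrows. -/
abbrev homMk (V : X.dom.V → Y.dom.V) (A : X.dom.A → Y.dom.A)
    (hs : ∀ a, Y.dom.s (A a) = V (X.dom.s a)) (ht : ∀ a, Y.dom.t (A a) = V (X.dom.t a))
    (hV : ∀ x, Y.str.onV (V x) = X.str.onV x) (hA : ∀ a, Y.str.onA (A a) = X.str.onA a) :
    X ⟶ Y :=
  Over.homMk (show FinQuiver.Hom X.dom Y.dom from ⟨V, A, hs, ht⟩) (FinQuiver.hom_ext hV hA)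

instance : Finite (X ⟶ Y) :=
  Finite.of_injective (fun f : X ⟶ Y => f.left) fun _ _ => Over.OverMorphism.ext

/-- The universal property of the fiber product over `Q`. -/
noncomputable def homFiberProductEquiv : (W ⟶ fiberProduct X Y) ≃ (W ⟶ X) × (W ⟶ Y) where
  toFun f :=
    (homMk (fun w => (onV f w).1.1) (fun a => (onA f a).1.1)
      (fun a => congrArg (fun p => p.1.1) (s_onA f a))
      (fun a => congrArg (fun p => p.1.1) (t_onA f a)) (str_onV f) (str_onA f),
    homMk (fun w => (onV f w).1.2) (fun a => (onA f a).1.2)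
      (fun a => congrArg (fun p => p.1.2) (s_onA f a))
      (fun a => congrArg (fun p => p.1.2) (t_onA f a))
      (fun w => (onV f w).2.symm.trans (str_onV f w))
      (fun a => (onA f a).2.symm.trans (str_onA f a)))
  invFun p := homMk
    (fun w => ⟨(onV p.1 w, onV p.2 w), (str_onV p.1 w).trans (str_onV p.2 w).symm⟩)
    (fun a => ⟨(onA p.1 a, onA p.2 a), (str_onA p.1 a).trans (str_onA p.2 a).symm⟩)
    (fun a => Subtype.ext (Prod.ext (s_onA p.1 a) (s_onA p.2 a)))
    (fun a => Subtype.ext (Prod.ext (t_onA p.1 a) (t_onA p.2 a)))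
    (str_onV p.1) (str_onA p.1)
  left_inv _ := hom_ext (fun _ => rfl) (fun _ => rfl)
  right_inv _ := Prod.ext (hom_ext (fun _ => rfl) (fun _ => rfl))
    (hom_ext (fun _ => rfl) (fun _ => rfl))

theorem card_hom_fiberProduct :
    Nat.card (W ⟶ fiberProduct X Y) = Nat.card (W ⟶ X) * Nat.card (W ⟶ Y) :=
  (Nat.card_congr homFiberProductEquiv).trans (Nat.card_prod _ _)

section DisjointUnion

variable {n : ℕ} (Z : Fin n → QuiverOver Q)

/-- The inclusion of a summand into a disjoint union. -/
def disjointUnionInclusion (i : Fin n) : Z i ⟶ disjointUnion Z :=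
  homMk (fun x => ⟨i, x⟩) (fun a => ⟨i, a⟩) (fun _ => rfl) (fun _ => rfl)
    (fun _ => rfl) (fun _ => rfl)

variable {Z}

theorem exists_comp_disjointUnionInclusion_eq {i : Fin n} (f : W ⟶ disjointUnion Z)
    (hf : ∀ w, (onV f w).1 = i) : ∃ g : W ⟶ Z i, g ≫ disjointUnionInclusion Z i = f := by
  have exists_mk {T : Fin n → Type u} (p : Σ j, T j) (hp : p.1 = i) : ∃ x : T i, ⟨i, x⟩ = p := by
    subst hp
    exact ⟨p.2, rfl⟩
  choose gV hgV using fun w => exists_mk (onV f w) (hf w)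
  choose gA hgA using fun a =>
    exists_mk (onA f a) ((congrArg Sigma.fst (s_onA f a)).trans (hf _))
  have mk_injective := sigma_mk_injective (β := fun j => (Z j).dom.V) (i := i)
  refine ⟨homMk gV gA (fun a => mk_injective ?_) (fun a => mk_injective ?_) (fun w => ?_)
    (fun a => ?_), hom_ext hgV hgA⟩
  · rw [hgV, ← s_onA, ← hgA]; rfl
  · rw [hgV, ← t_onA, ← hgA]; rfl
  · rw [← str_onV f, ← hgV]; rfl
  · rw [← str_onA f, ← hgA]; rfl

theorem exists_factor_of_isConnected (hW : W.dom.IsConnected) (f : W ⟶ disjointUnion Z) :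
    ∃ i, ∃ g : W ⟶ Z i, g ≫ disjointUnionInclusion Z i = f := by
  obtain ⟨w₀⟩ := hW.1
  have hs a : (onA f a).1 = (onV f (W.dom.s a)).1 := congrArg Sigma.fst (s_onA f a)
  have ht a : (onA f a).1 = (onV f (W.dom.t a)).1 := congrArg Sigma.fst (t_onA f a)
  exact ⟨_, exists_comp_disjointUnionInclusion_eq f fun w =>
    hW.eq_of_forall_arrow (c := fun w => (onV f w).1) (fun a => (hs a).symm.trans (ht a)) w w₀⟩

theorem sigma_comp_disjointUnionInclusion_injective (hW : Nonempty W.dom.V) :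
    Function.Injective fun p : Σ i, (W ⟶ Z i) => p.2 ≫ disjointUnionInclusion Z p.1 := by
  rintro ⟨i, f⟩ ⟨j, g⟩ h
  have hV w : (⟨i, onV f w⟩ : Σ i, (Z i).dom.V) = ⟨j, onV g w⟩ :=
    congrArg (fun k : W ⟶ disjointUnion Z => onV k w) h
  have hA a : (⟨i, onA f a⟩ : Σ i, (Z i).dom.A) = ⟨j, onA g a⟩ :=
    congrArg (fun k : W ⟶ disjointUnion Z => onA k a) h
  obtain ⟨w₀⟩ := hW
  obtain rfl : i = j := congrArg Sigma.fst (hV w₀)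
  exact congrArg (Sigma.mk i) (hom_ext (fun w => eq_of_heq (Sigma.mk.inj (hV w)).2)
    fun a => eq_of_heq (Sigma.mk.inj (hA a)).2)

theorem card_hom_disjointUnion (hW : W.dom.IsConnected) :
    Nat.card (W ⟶ disjointUnion Z) = ∑ i, Nat.card (W ⟶ Z i) := by
  rw [← Nat.card_sigma]
  refine (Nat.card_eq_of_bijective _
    ⟨sigma_comp_disjointUnionInclusion_injective hW.1, fun f => ?_⟩).symm
  obtain ⟨i, g, hg⟩ := exists_factor_of_isConnected hW f
  exact ⟨⟨i, g⟩, hg⟩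

end DisjointUnion

end QuiverOver

end CountingMorphisms

section Linearization

variable {K : Type u} [Field K] {Q : FinQuiver.{u}}

namespace FinQuiver.Hom

variable {Q' : FinQuiver.{u}} (f : FinQuiver.Hom Q' Q)

/-- The vertices over the vertex `x`. -/
abbrev FiberV (x : Q.V) : Type u := {y : Q'.V // f.onV y = x}

/-- The arrows over the arrow `α`. -/
abbrev FiberA (α : Q.A) : Type u := {β : Q'.A // f.onA β = α}

open scoped Classical in
noncomputable instance (α : Q.A) : Fintype (f.FiberA α) :=
  inferInstance

/-- The start of an arrow over `α`, as a vertex over the start of `α`. -/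
abbrev fiberS (α : Q.A) (β : f.FiberA α) : f.FiberV (Q.s α) :=
  ⟨Q'.s β.1, by rw [← f.s_onA, β.2]⟩

/-- The terminal vertex of an arrow over `α`, as a vertex over the terminal vertex of `α`. -/
abbrev fiberT (α : Q.A) (β : f.FiberA α) : f.FiberV (Q.t α) :=
  ⟨Q'.t β.1, by rw [← f.t_onA, β.2]⟩

end FinQuiver.Hom

/-- Bases of the spaces of a representation in which the arrows act as they do in the linearization
of a quiver over `Q`. That quiver is given by its fibers `I x` and `J α` over the vertices and the
arrows of `Q`, and by its structure maps `σ` and `τ` between these fibers. -/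
structure ArrowBasis {I : Q.V → Type*} {J : Q.A → Type*} [∀ α, Fintype (J α)]
    (σ : ∀ α, J α → I (Q.s α)) (τ : ∀ α, J α → I (Q.t α)) (V : QRep K Q) where
  basis : ∀ x, Module.Basis (I x) K (V.space x)
  map_apply : ∀ α v, V.map α v = ∑ j, (basis _).repr v (σ α j) • basis _ (τ α j)

namespace QRep

/-- The direct sum of a finite family of representations. -/
abbrev pi {n : ℕ} (V : Fin n → QRep K Q) : QRep K Q where
  space x := ∀ i, (V i).space x
  map α := LinearMap.piMap fun i => (V i).map α

end QRep

namespace ArrowBasis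

variable {I I' : Q.V → Type*} {J J' : Q.A → Type*} [∀ α, Fintype (J α)] [∀ α, Fintype (J' α)]
  {σ : ∀ α, J α → I (Q.s α)} {τ : ∀ α, J α → I (Q.t α)}
  {σ' : ∀ α, J' α → I' (Q.s α)} {τ' : ∀ α, J' α → I' (Q.t α)} {V W : QRep K Q}

/-- Representations with bases modelled on isomorphic quivers over `Q` are isomorphic. -/
noncomputable def iso (b : ArrowBasis σ τ V) (c : ArrowBasis σ' τ' W) (eI : ∀ x, I x ≃ I' x)
    (eJ : ∀ α, J α ≃ J' α) (hσ : ∀ α j, σ' α (eJ α j) = eI _ (σ α j))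
    (hτ : ∀ α j, τ' α (eJ α j) = eI _ (τ α j)) : V.Iso W where
  equiv x := (b.basis x).equiv (c.basis x) (eI x)
  comm α v := by
    have repr_equiv {x} (v : V.space x) (i : I x) : (c.basis x).repr
        ((b.basis x).equiv (c.basis x) (eI x) v) (eI x i) = (b.basis x).repr v i := by
      rw [← (eI x).symm_symm, ← Module.Basis.repr_reindex_apply, Equiv.symm_symm]
      simp only [Module.Basis.equiv, LinearEquiv.trans_apply, LinearEquiv.apply_symm_apply]
    rw [b.map_apply, c.map_apply, map_sum, ← (eJ α).sum_comp]
    refine Finset.sum_congr rfl fun j _ => ?_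
    rw [map_smul, Module.Basis.equiv_apply, hσ, hτ, repr_equiv]

open scoped Classical in
variable (K) in
/-- The basis `(e_y)` of a linearization. -/
noncomputable def linearization (X : QuiverOver Q) :
    ArrowBasis X.str.fiberS X.str.fiberT (QRep.linearization K X) where
  basis x := Pi.basisFun K (X.str.FiberV x)
  map_apply α v := by
    rw [LinearMap.sum_apply]
    refine Finset.sum_congr rfl fun β _ => ?_
    simp [← Pi.single_smul]

/-- The tensor product of two bases; it is modelled on the fiber product. -/
noncomputable def tensor (b : ArrowBasis σ τ V) (c : ArrowBasis σ' τ' W) :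
    ArrowBasis (I := fun x => I x × I' x) (J := fun α => J α × J' α)
      (fun α => Prod.map (σ α) (σ' α)) (fun α => Prod.map (τ α) (τ' α)) (V.tensor W) where
  basis x := (b.basis x).tensorProduct (c.basis x)
  map_apply α v := by
    induction v using TensorProduct.induction_on with
    | zero => simp
    | add v w hv hw => simp only [map_add, hv, hw, Finsupp.add_apply, add_smul,
        Finset.sum_add_distrib]
    | tmul v w =>
      rw [TensorProduct.map_tmul, b.map_apply, c.map_apply, TensorProduct.sum_tmul,
        Fintype.sum_prod_type]
      simp only [TensorProduct.tmul_sum, TensorProduct.smul_tmul_smul, Prod.map_apply,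
        Module.Basis.tensorProduct_repr_tmul_apply, Module.Basis.tensorProduct_apply, smul_eq_mul,
        mul_comm]

/-- The direct sum of bases; it is modelled on the disjoint union. -/
noncomputable def pi {n : ℕ} {I : Fin n → Q.V → Type*} {J : Fin n → Q.A → Type*}
    [∀ i α, Fintype (J i α)] {σ : ∀ i α, J i α → I i (Q.s α)} {τ : ∀ i α, J i α → I i (Q.t α)}
    {V : Fin n → QRep K Q} (b : ∀ i, ArrowBasis (σ i) (τ i) (V i)) :
    ArrowBasis (I := fun x => Σ i, I i x) (J := fun α => Σ i, J i α)
      (fun α => Sigma.map id fun i => σ i α) (fun α => Sigma.map id fun i => τ i α)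
      (QRep.pi V) where
  basis x := Pi.basis fun i => (b i).basis x
  map_apply α v := by
    ext i
    rw [Fintype.sum_sigma, Finset.sum_apply, Finset.sum_eq_single_of_mem i (Finset.mem_univ i)]
    · simp [(b i).map_apply, Sigma.map, Pi.basis_apply]
    · intro j _ hji
      simp [Sigma.map, Pi.basis_apply, Pi.single_eq_of_ne hji.symm]

variable (K Q) in
/-- The basis `1` of each space of the identity representation; it is modelled on `Q` itself. -/
noncomputable def one : ArrowBasis (I := fun _ => Unit) (J := fun _ => Unit)
    (fun _ => id) (fun _ => id) (QRep.one K Q) where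
  basis _ := Module.Basis.singleton Unit K
  map_apply α v := by simp

end ArrowBasis

namespace RepRing

theorem of_eq_of_iso {V W : QRep K Q} (e : V.Iso W) : of V = of W :=
  congrArg (fun c => Ideal.Quotient.mk (relIdeal K Q) (FreeAbelianGroup.of c)) (Quotient.sound ⟨e⟩)

theorem of_one : of (QRep.one K Q) = 1 :=
  rfl

theorem of_tensor (V W : QRep K Q) : of (V.tensor W) = of V * of W := by
  rw [of, of, of, ← map_mul, ← FreeAbelianGroup.of_mul]
  rfl

theorem of_directSum (V W : QRep K Q) : of (V.directSum W) = of V + of W := by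
  rw [← sub_eq_zero, ← sub_sub]
  exact Ideal.Quotient.eq_zero_iff_mem.2 (AddSubgroup.subset_closure ⟨V, W, rfl⟩)

theorem of_eq_zero {V : QRep K Q} (hV : V.IsZero) : of V = 0 := by
  have (x : Q.V) : Unique (V.space x) := have := hV x; uniqueOfSubsingleton 0
  have e : (V.directSum V).Iso V := ⟨fun _ => LinearEquiv.prodUnique, fun _ _ => rfl⟩
  have h := of_eq_of_iso e
  rwa [of_directSum, add_eq_left] at h

theorem of_pi {n : ℕ} (V : Fin n → QRep K Q) : of (QRep.pi V) = ∑ i, of (V i) := by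
  induction n with
  | zero =>
    rw [Fin.sum_univ_zero]
    exact of_eq_zero fun _ => inferInstanceAs (Subsingleton (∀ i : Fin 0, _))
  | succ n ih =>
    have e : ((V 0).directSum (QRep.pi fun i => V i.succ)).Iso (QRep.pi V) :=
      ⟨fun x => Fin.consLinearEquiv K fun i => (V i).space x, fun α v => by
        ext i
        cases i using Fin.cases <;> rfl⟩
    rw [Fin.sum_univ_succ, ← of_eq_of_iso e, of_directSum, ih]

theorem of_linearization_congr {X Y : QuiverOver Q} (e : X ≅ Y) :
    of (QRep.linearization K X) = of (QRep.linearization K Y) := by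
  let eI x : X.str.FiberV x ≃ Y.str.FiberV x :=
    { toFun y := ⟨QuiverOver.onV e.hom y, (QuiverOver.str_onV e.hom y).trans y.2⟩
      invFun y := ⟨QuiverOver.onV e.inv y, (QuiverOver.str_onV e.inv y).trans y.2⟩
      left_inv y := Subtype.ext (congrArg (QuiverOver.onV · y.1) e.hom_inv_id)
      right_inv y := Subtype.ext (congrArg (QuiverOver.onV · y.1) e.inv_hom_id) }
  let eJ α : X.str.FiberA α ≃ Y.str.FiberA α :=
    { toFun β := ⟨QuiverOver.onA e.hom β, (QuiverOver.str_onA e.hom β).trans β.2⟩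
      invFun β := ⟨QuiverOver.onA e.inv β, (QuiverOver.str_onA e.inv β).trans β.2⟩
      left_inv β := Subtype.ext (congrArg (QuiverOver.onA · β.1) e.hom_inv_id)
      right_inv β := Subtype.ext (congrArg (QuiverOver.onA · β.1) e.inv_hom_id) }
  exact of_eq_of_iso ((ArrowBasis.linearization K X).iso (ArrowBasis.linearization K Y) eI eJ
    (fun _ β => Subtype.ext (QuiverOver.s_onA e.hom β))
    (fun _ β => Subtype.ext (QuiverOver.t_onA e.hom β)))

theorem of_linearization_fiberProduct (X Y : QuiverOver Q) :
    of (QRep.linearization K (fiberProduct X Y)) =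
      of (QRep.linearization K X) * of (QRep.linearization K Y) := by
  let eI x : (fiberProduct X Y).str.FiberV x ≃ X.str.FiberV x × Y.str.FiberV x :=
    { toFun p := (⟨p.1.1.1, p.2⟩, ⟨p.1.1.2, p.1.2.symm.trans p.2⟩)
      invFun p := ⟨⟨(p.1.1, p.2.1), p.1.2.trans p.2.2.symm⟩, p.1.2⟩ }
  let eJ α : (fiberProduct X Y).str.FiberA α ≃ X.str.FiberA α × Y.str.FiberA α :=
    { toFun p := (⟨p.1.1.1, p.2⟩, ⟨p.1.1.2, p.1.2.symm.trans p.2⟩)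
      invFun p := ⟨⟨(p.1.1, p.2.1), p.1.2.trans p.2.2.symm⟩, p.1.2⟩ }
  rw [← of_tensor]
  exact of_eq_of_iso ((ArrowBasis.linearization K _).iso
    ((ArrowBasis.linearization K X).tensor (ArrowBasis.linearization K Y)) eI eJ
    (fun _ _ => rfl) (fun _ _ => rfl))

theorem of_linearization_disjointUnion {n : ℕ} (X : Fin n → QuiverOver Q) :
    of (QRep.linearization K (disjointUnion X)) = ∑ i, of (QRep.linearization K (X i)) := by
  let eI x : (disjointUnion X).str.FiberV x ≃ Σ i, (X i).str.FiberV x :=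
    { toFun p := ⟨p.1.1, p.1.2, p.2⟩
      invFun p := ⟨⟨p.1, p.2.1⟩, p.2.2⟩ }
  let eJ α : (disjointUnion X).str.FiberA α ≃ Σ i, (X i).str.FiberA α :=
    { toFun p := ⟨p.1.1, p.1.2, p.2⟩
      invFun p := ⟨⟨p.1, p.2.1⟩, p.2.2⟩ }
  rw [← of_pi]
  exact of_eq_of_iso ((ArrowBasis.linearization K _).iso
    (ArrowBasis.pi fun i => ArrowBasis.linearization K (X i)) eI eJ
    (fun _ _ => rfl) (fun _ _ => rfl))

theorem of_linearization_id :
    of (QRep.linearization K (Over.mk (𝟙 Q) : QuiverOver Q)) = 1 := by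
  let eI x : FinQuiver.Hom.FiberV (𝟙 Q) x ≃ Unit :=
    { toFun _ := ()
      invFun _ := ⟨x, rfl⟩
      left_inv p := Subtype.ext p.2.symm }
  let eJ α : FinQuiver.Hom.FiberA (𝟙 Q) α ≃ Unit :=
    { toFun _ := ()
      invFun _ := ⟨α, rfl⟩
      left_inv p := Subtype.ext p.2.symm }
  rw [← of_one]
  exact of_eq_of_iso ((ArrowBasis.linearization K _).iso (ArrowBasis.one K Q) eI eJ
    (fun _ _ => rfl) (fun _ _ => rfl))

end RepRing

end Linearization

section Multiplicity

open Limits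

variable (K : Type*) [Field K] {A : Type*} [Category* A] [Preadditive A] [Linear K A]
  (X : A) [IsLocalRing (End X)]

/-- The radical morphisms `X ⟶ M` for an object `X` with local endomorphism ring: those no
composite of which with a morphism `M ⟶ X` is invertible. -/
def homRadical (M : A) : Submodule K (X ⟶ M) where
  carrier := {f | ∀ g : M ⟶ X, ¬ IsIso (f ≫ g)}
  zero_mem' g h := by
    rw [zero_comp, ← isUnit_iff_isIso] at h
    exact not_isUnit_zero (M₀ := End X) h
  add_mem' {f₁ f₂} h₁ h₂ g h := by
    rw [Preadditive.add_comp, ← isUnit_iff_isIso] at h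
    exact (IsLocalRing.isUnit_or_isUnit_of_isUnit_add (R := End X) h).elim
      (fun h => h₁ g ((isUnit_iff_isIso _).1 h)) fun h => h₂ g ((isUnit_iff_isIso _).1 h)
  smul_mem' c f hf g h := hf (c • g) (by rwa [Linear.comp_smul, ← Linear.smul_comp])

/-- The functor `M ↦ Hom(X, M) / rad(X, M)`. -/
def homModRadical : A ⥤ ModuleCat K where
  obj M := ModuleCat.of K ((X ⟶ M) ⧸ homRadical K X M)
  map h := ModuleCat.ofHom (Submodule.mapQ _ _ (Linear.rightComp K X h) fun f hf g => by
    simpa only [Linear.rightComp_apply, Category.assoc] using hf (h ≫ g))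
  map_id M := by
    ext f
    exact congrArg _ (Category.comp_id f)
  map_comp h k := by
    ext f
    exact congrArg _ (Category.assoc f h k).symm

instance : (homModRadical K X).Additive where
  map_add {_ _ h k} := ModuleCat.hom_ext (Submodule.linearMap_qext _ (LinearMap.ext fun f =>
    congrArg (homRadical K X _).mkQ (Preadditive.comp_add _ _ _ f h k)))

/-- The multiplicity, up to the positive factor `dim_K (End X / rad)`, of an object `X` with local
endomorphism ring as a direct summand of `M`. -/
noncomputable def multiplicity (M : A) : ℕ :=
  Module.finrank K ((homModRadical K X).obj M)

theorem multiplicity_congr {M N : A} (e : M ≅ N) : multiplicity K X M = multiplicity K X N :=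
  ((homModRadical K X).mapIso e).toLinearEquiv.finrank_eq

theorem multiplicity_biprod (M N : A) [HasBinaryBiproducts A] [FiniteDimensional K (X ⟶ M)]
    [FiniteDimensional K (X ⟶ N)] :
    multiplicity K X (M ⊞ N) = multiplicity K X M + multiplicity K X N := by
  have (M : A) [FiniteDimensional K (X ⟶ M)] : Module.Finite K ((homModRadical K X).obj M) :=
    inferInstanceAs (Module.Finite K ((X ⟶ M) ⧸ homRadical K X M))
  have := preservesBinaryBiproducts_of_preservesBiproducts (homModRadical K X)
  exact ((homModRadical K X).mapBiprod M N ≪≫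
    ModuleCat.biprodIsoProd _ _).toLinearEquiv.finrank_eq.trans Module.finrank_prod

theorem multiplicity_self_pos [FiniteDimensional K (X ⟶ X)] : 0 < multiplicity K X X := by
  have id_notMem : 𝟙 X ∉ homRadical K X X := fun h => h (𝟙 X) inferInstance
  have : Nontrivial ((X ⟶ X) ⧸ homRadical K X X) :=
    Submodule.Quotient.nontrivial_iff.2 fun h => id_notMem (h ▸ Submodule.mem_top)
  exact Module.finrank_pos (R := K) (M := (X ⟶ X) ⧸ homRadical K X X)

variable {X} in
/-- If `f ≫ g` is invertible, then `g ≫ (f ≫ g)⁻¹ ≫ f` is a nonzero idempotent of the local ring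
`End Y`, hence the identity. -/
theorem isIso_of_isIso_comp {Y : A} [IsLocalRing (End Y)] (f : X ⟶ Y) (g : Y ⟶ X)
    [IsIso (f ≫ g)] : IsIso f := by
  let r : Y ⟶ X := g ≫ inv (f ≫ g)
  have hr : f ≫ r = 𝟙 X := by rw [← Category.assoc, IsIso.hom_inv_id]
  have hf : f ≫ (𝟙 Y - r ≫ f) = 0 := by
    rw [Preadditive.comp_sub, Category.comp_id, ← Category.assoc, hr, Category.id_comp, sub_self]
  rcases IsLocalRing.isUnit_or_isUnit_of_add_one (R := End Y)
    (show (r ≫ f) + (𝟙 Y - r ≫ f) = 𝟙 Y from add_sub_cancel _ _) with h | h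
  · have := (isUnit_iff_isIso _).1 h
    have : IsSplitMono f := .mk' ⟨r, hr⟩
    have : Epi f := epi_of_epi r f
    exact isIso_of_epi_of_isSplitMono f
  · have := (isUnit_iff_isIso _).1 h
    have h0 : f = 0 := by rw [← cancel_mono (𝟙 Y - r ≫ f), hf, zero_comp]
    exact absurd (by rw [← hr, h0, zero_comp] : 𝟙 X = 0) (one_ne_zero (α := End X))

variable {X} in
theorem multiplicity_eq_zero {Y : A} [IsLocalRing (End Y)] (h : IsEmpty (X ≅ Y)) :
    multiplicity K X Y = 0 := by
  have hrad : homRadical K X Y = ⊤ := eq_top_iff.2 fun f _ g _ =>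
    have := isIso_of_isIso_comp f g
    h.false (asIso f)
  have : Subsingleton ((X ⟶ Y) ⧸ homRadical K X Y) :=
    Submodule.Quotient.subsingleton_iff.2 hrad
  exact Module.finrank_zero_of_subsingleton (R := K) (M := (X ⟶ Y) ⧸ homRadical K X Y)

end Multiplicity

section KrullSchmidt

open Limits

variable {K : Type u} [Field K] {Q : FinQuiver.{u}}

namespace QRep

/-- The space of homomorphisms of representations, as a subspace of the space of families of linear
maps. -/
def homSpace (V W : QRep K Q) : Submodule K (∀ x, V.space x →ₗ[K] W.space x) where
  carrier := {f | ∀ α v, f (Q.t α) (V.map α v) = W.map α (f (Q.s α) v)}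
  zero_mem' α _ := (map_zero (W.map α)).symm
  add_mem' hf hg α v := by simp [hf α v, hg α v]
  smul_mem' c f hf α v := by simp [hf α v]

instance : Category (QRep K Q) where
  Hom V W := homSpace V W
  id V := ⟨fun _ => LinearMap.id, fun _ _ => rfl⟩
  comp f g := ⟨fun x => g.1 x ∘ₗ f.1 x, fun α v =>
    (congrArg (g.1 _) (f.2 α v)).trans (g.2 α (f.1 _ v))⟩

instance : Preadditive (QRep K Q) where
  homGroup V W := inferInstanceAs (AddCommGroup (homSpace V W))
  add_comp _ _ _ _ _ g := Subtype.ext (funext fun x => LinearMap.comp_add _ _ (g.1 x))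
  comp_add _ _ _ _ _ _ := rfl

instance : Linear K (QRep K Q) where
  homModule V W := inferInstanceAs (Module K (homSpace V W))
  smul_comp _ _ _ c f g := Subtype.ext (funext fun x => LinearMap.comp_smul (g.1 x) c (f.1 x))
  comp_smul _ _ _ _ _ _ := rfl

instance (V W : QRep K Q) : FiniteDimensional K (V ⟶ W) :=
  inferInstanceAs (FiniteDimensional K (homSpace V W))

theorem hom_ext {V W : QRep K Q} {f g : V ⟶ W} (h : ∀ x v, f.1 x v = g.1 x v) : f = g :=
  Subtype.ext (funext fun x => LinearMap.ext (h x))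

/-- An isomorphism of representations, as an isomorphism in the category of representations. -/
def Iso.toCatIso {V W : QRep K Q} (e : V.Iso W) : V ≅ W where
  hom := ⟨fun x => e.equiv x, e.comm⟩
  inv := ⟨fun x => e.symm.equiv x, e.symm.comm⟩
  hom_inv_id := hom_ext fun x => (e.equiv x).symm_apply_apply
  inv_hom_id := hom_ext fun x => (e.equiv x).apply_symm_apply

/-- The isomorphism of representations underlying an isomorphism in their category. -/
def Iso.ofCatIso {V W : QRep K Q} (e : V ≅ W) : V.Iso W where
  equiv x := LinearEquiv.ofLinearMap (e.hom.1 x) (e.inv.1 x)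
    (congrArg (fun f : W ⟶ W => f.1 x) e.inv_hom_id)
    (congrArg (fun f : V ⟶ V => f.1 x) e.hom_inv_id)
  comm := e.hom.2

theorem isIso_of_bijective {V W : QRep K Q} (f : V ⟶ W) (hf : ∀ x, Function.Bijective (f.1 x)) :
    IsIso f :=
  let e : V.Iso W := ⟨fun x => LinearEquiv.ofBijective (f.1 x) (hf x), f.2⟩
  e.toCatIso.isIso_hom

/-- The structure maps of the direct sum as a biproduct. -/
abbrev directSumBicone (V W : QRep K Q) : BinaryBicone V W where
  pt := V.directSum W
  fst := ⟨fun _ => LinearMap.fst K _ _, fun _ _ => rfl⟩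
  snd := ⟨fun _ => LinearMap.snd K _ _, fun _ _ => rfl⟩
  inl := ⟨fun _ => LinearMap.inl K _ _, fun α _ => Prod.ext rfl (map_zero (W.map α)).symm⟩
  inr := ⟨fun _ => LinearMap.inr K _ _, fun α _ => Prod.ext (map_zero (V.map α)).symm rfl⟩

/-- The direct sum of representations is their biproduct. -/
def directSumIsBilimit (V W : QRep K Q) : (directSumBicone V W).IsBilimit :=
  isBinaryBilimitOfTotal _ (hom_ext fun x (v : V.space x × W.space x) =>
    Prod.ext (add_zero v.1) (zero_add v.2))

instance : HasBinaryBiproducts (QRep K Q) where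
  has_binary_biproduct V W := ⟨⟨⟨directSumBicone V W, directSumIsBilimit V W⟩⟩⟩

theorem multiplicity_directSum (X V W : QRep K Q) [IsLocalRing (End X)] :
    multiplicity K X (V.directSum W) = multiplicity K X V + multiplicity K X W :=
  (multiplicity_congr K X (biprod.uniqueUpToIso V W (directSumIsBilimit V W))).trans
    (multiplicity_biprod K X V W)

/-- A family of subspaces that is stable under the maps of a representation. -/
def IsStable (V : QRep K Q) (S : ∀ x, Submodule K (V.space x)) : Prop :=
  ∀ α, ∀ v ∈ S (Q.s α), V.map α v ∈ S (Q.t α)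

/-- The subrepresentation on a stable family of subspaces. -/
abbrev sub (V : QRep K Q) (S : ∀ x, Submodule K (V.space x)) (hS : V.IsStable S) : QRep K Q where
  space x := S x
  map α := (V.map α).restrict (hS α)

theorem isStable_ker {V W : QRep K Q} (f : V ⟶ W) : V.IsStable fun x => LinearMap.ker (f.1 x) :=
  fun α v hv => by
    rw [LinearMap.mem_ker] at hv ⊢
    rw [f.2, hv, map_zero]

theorem isStable_range {V W : QRep K Q} (f : V ⟶ W) :
    W.IsStable fun x => LinearMap.range (f.1 x) := by
  rintro α _ ⟨v, rfl⟩
  exact ⟨_, f.2 α v⟩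

theorem IsIndecomposable.eq_bot_or_eq_bot {V : QRep K Q} (hV : V.IsIndecomposable)
    {S T : ∀ x, Submodule K (V.space x)} (hS : V.IsStable S) (hT : V.IsStable T)
    (h : ∀ x, IsCompl (S x) (T x)) : (∀ x, S x = ⊥) ∨ ∀ x, T x = ⊥ := by
  let e : ((V.sub S hS).directSum (V.sub T hT)).Iso V :=
    ⟨fun x => Submodule.prodEquivOfIsCompl (S x) (T x) (h x), fun α v => by simp⟩
  exact (hV.2 _ _ ⟨e.symm⟩).imp (fun h x => Submodule.subsingleton_iff_eq_bot.1 (h x))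
    (fun h x => Submodule.subsingleton_iff_eq_bot.1 (h x))

theorem pow_apply {V : QRep K Q} (f : End V) (n : ℕ) (x : Q.V) : (f ^ n).1 x = f.1 x ^ n := by
  induction n with
  | zero => rfl
  | succ n ih => rw [pow_succ, pow_succ, ← ih]; rfl

/-- Fitting: for large `n` the kernel and the range of `f ^ n` are complementary
subrepresentations. -/
theorem IsIndecomposable.isUnit_or_isNilpotent {V : QRep K Q} (hV : V.IsIndecomposable)
    (f : End V) : IsUnit f ∨ IsNilpotent f := by
  obtain ⟨n, hn, n_pos⟩ : ∃ n, (∀ x, IsCompl (LinearMap.ker (f.1 x ^ n))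
      (LinearMap.range (f.1 x ^ n))) ∧ 0 < n :=
    ((Filter.eventually_all.2 fun x =>
      LinearMap.eventually_isCompl_ker_pow_range_pow (f.1 x)).and
        (Filter.eventually_gt_atTop 0)).exists
  simp only [← pow_apply] at hn
  refine (hV.eq_bot_or_eq_bot (isStable_ker _) (isStable_range _) hn).imp (fun h => ?_) fun h => ?_
  · refine (isUnit_pow_iff n_pos.ne').1 ((isUnit_iff_isIso _).2 (isIso_of_bijective _ fun x => ?_))
    have inj := LinearMap.ker_eq_bot.1 (h x)
    exact ⟨inj, LinearMap.injective_iff_surjective.1 inj⟩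
  · exact ⟨n, Subtype.ext (funext fun x => LinearMap.range_eq_bot.1 (h x))⟩

theorem IsIndecomposable.isLocalRing_end {V : QRep K Q} (hV : V.IsIndecomposable) :
    IsLocalRing (End V) := by
  have : Nontrivial (End V) := by
    refine ⟨1, 0, fun h => hV.1 fun x => subsingleton_of_forall_eq 0 fun v => ?_⟩
    exact congrArg (fun f : End V => f.1 x v) h
  exact .of_isUnit_or_isUnit_one_sub_self fun f =>
    (hV.isUnit_or_isNilpotent f).imp_right fun h => h.isUnit_one_sub

end QRep

namespace RepRing

/-- The homomorphism from the representation ring induced by an additive invariant of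
representations. -/
noncomputable def lift {A : Type*} [AddCommGroup A] (φ : QRep K Q → A)
    (congr : ∀ V W, V.Iso W → φ V = φ W) (add : ∀ V W, φ (V.directSum W) = φ V + φ W) :
    RepRing K Q →+ A :=
  QuotientAddGroup.lift _
    (FreeAbelianGroup.lift <|
      show IsoClass K Q → A from Quotient.lift φ fun V W ⟨e⟩ => congr V W e) <| by
    change relSubgroup K Q ≤ _
    rw [relSubgroup, AddSubgroup.closure_le]
    rintro _ ⟨V, W, rfl⟩
    rw [SetLike.mem_coe, AddMonoidHom.mem_ker, map_sub, map_sub, FreeAbelianGroup.lift_apply_of,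
      FreeAbelianGroup.lift_apply_of, FreeAbelianGroup.lift_apply_of, sub_sub]
    exact sub_eq_zero.2 (add V W)

theorem lift_of {A : Type*} [AddCommGroup A] (φ : QRep K Q → A)
    (congr : ∀ V W, V.Iso W → φ V = φ W) (add : ∀ V W, φ (V.directSum W) = φ V + φ W)
    (V : QRep K Q) : lift φ congr add (of V) = φ V :=
  FreeAbelianGroup.lift_apply_of _ _

/-- The multiplicity of `X` in `V`, as a function of the class of `V`. -/
noncomputable def multiplicityHom (X : QRep K Q) [IsLocalRing (End X)] : RepRing K Q →+ ℤ :=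
  lift (fun V => (multiplicity K X V : ℤ))
    (fun _ _ e => congrArg _ (multiplicity_congr K X e.toCatIso))
    fun V W => by rw [QRep.multiplicity_directSum, Nat.cast_add]

theorem multiplicityHom_of (X V : QRep K Q) [IsLocalRing (End X)] :
    multiplicityHom X (of V) = multiplicity K X V :=
  lift_of _ _ _ V

theorem linearIndependent_of {ι : Type*} {V : ι → QRep K Q} (hV : ∀ i, (V i).IsIndecomposable)
    (hne : Pairwise fun i j => IsEmpty ((V i).Iso (V j))) :
    LinearIndependent ℤ fun i => of (V i) := by
  have (i : ι) : IsLocalRing (End (V i)) := (hV i).isLocalRing_end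
  refine linearIndependent_iff.2 fun a ha => Finsupp.ext fun i => ?_
  have h := congrArg (multiplicityHom (V i)) ha
  rw [Finsupp.linearCombination_apply, map_finsuppSum, map_zero,
    Finsupp.sum_eq_single i ?_ (fun _ => by rw [zero_smul, map_zero]), map_zsmul,
    multiplicityHom_of] at h
  · exact (smul_eq_zero.1 h).resolve_right
      (Nat.cast_ne_zero.2 (multiplicity_self_pos K (V i)).ne')
  · intro j _ hji
    have : IsEmpty (V i ≅ V j) := ⟨fun e => (hne hji.symm).false (.ofCatIso e)⟩
    rw [map_zsmul, multiplicityHom_of, multiplicity_eq_zero K this, Nat.cast_zero, smul_zero]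

end RepRing

end KrullSchmidt

section LinearizationMap

variable {K : Type u} [Field K] {Q : FinQuiver.{u}} {C : ObjectProperty (QuiverOver Q)}

theorem linearizationMap_single (X : C.FullSubcategory) :
    linearizationMap K C (.single X 1) = RepRing.of (QRep.linearization K X.obj) := by
  rw [linearizationMap, Finsupp.linearCombination_single, one_smul]

theorem linearizationMap_injective
    (hindec : ∀ X, C X → (QRep.linearization K X).IsIndecomposable)
    (hiso : ∀ X Y, C X → C Y → X ≠ Y →
      IsEmpty ((QRep.linearization K X).Iso (QRep.linearization K Y))) :
    Function.Injective (linearizationMap K C) :=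
  RepRing.linearIndependent_of (fun X : C.FullSubcategory => hindec _ X.property) fun X Y hXY =>
    hiso _ _ X.property Y.property fun h => hXY (ObjectProperty.FullSubcategory.ext h)

theorem marks_prod_linearizationMap_mul_mem_range (hconn : ∀ X, C X → X.dom.IsConnected)
    (hfiber : ClosedUnderFiberProducts C) (X Y : C.FullSubcategory) :
    (marks _).prod (linearizationMap K C) (.single X 1) *
        (marks _).prod (linearizationMap K C) (.single Y 1) ∈
      ((marks _).prod (linearizationMap K C)).range := by
  obtain ⟨n, Z, hZ, ⟨e⟩⟩ := hfiber X.obj Y.obj X.property Y.property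
  have card_hom (W W' : C.FullSubcategory) : Nat.card (W ⟶ W') = Nat.card (W.obj ⟶ W'.obj) :=
    Nat.card_congr C.fullyFaithfulι.homEquiv
  refine ⟨∑ i, .single ⟨Z i, hZ i⟩ 1, Prod.ext (funext fun W => ?_) ?_⟩
  · have hcard : ∑ i, Nat.card (W.obj ⟶ Z i) =
        Nat.card (W.obj ⟶ X.obj) * Nat.card (W.obj ⟶ Y.obj) := by
      rw [← QuiverOver.card_hom_fiberProduct, Nat.card_congr e.homToEquiv,
        QuiverOver.card_hom_disjointUnion (hconn _ W.property)]
    change marks _ _ W = marks _ _ W * marks _ _ W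
    simp only [map_sum, Finset.sum_apply, marks_single_apply, one_mul, card_hom]
    exact_mod_cast hcard
  · change linearizationMap K C _ = linearizationMap K C _ * linearizationMap K C _
    simp only [map_sum, linearizationMap_single]
    rw [← RepRing.of_linearization_fiberProduct, RepRing.of_linearization_congr e,
      RepRing.of_linearization_disjointUnion]

variable (C) in
/-- The base quiver as a terminal object of a full subcategory containing it. -/
noncomputable def isTerminalBase (hC : C (Over.mk (𝟙 Q))) :
    Limits.IsTerminal (⟨Over.mk (𝟙 Q), hC⟩ : C.FullSubcategory) :=
  Limits.IsTerminal.isTerminalOfObj C.ι _ Over.mkIdTerminal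

end LinearizationMap

end QuiverRep

theorem mainTheorem3 {K : Type u} [Field K] {Q : FinQuiver.{u}}
    (C : ObjectProperty (QuiverOver Q))
    [LowerFinite C.FullSubcategory]
    (hacyclic : IsAcyclicCategory C.FullSubcategory)
    (hconn : ∀ X, C X → X.dom.IsConnected)
    (hwrap : ∀ X, C X → X.str.IsWrapping)
    (hfiber : ClosedUnderFiberProducts C)
    (hindec : ∀ X, C X → (QRep.linearization K X).IsIndecomposable)
    (hiso : ∀ X Y, C X → C Y → X ≠ Y →
      IsEmpty ((QRep.linearization K X).Iso (QRep.linearization K Y))) :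
    (OrthogonalIdempotents
        (fun x : C.FullSubcategory => linearizationMap K C (delta x)) ∧
      ∃ b : Module.Basis C.FullSubcategory ℤ
          (NonUnitalSubring.closure
            (Set.range fun x : C.FullSubcategory => RepRing.of (QRep.linearization K x.obj))),
        ∀ x, (b x : RepRing K Q) = linearizationMap K C (delta x)) ∧
    (C (Over.mk (𝟙 Q)) →
      ∃ Φ : RepRing K Q ≃+*
          ((x : C.FullSubcategory) →
            (Ideal.span {linearizationMap K C (delta x)} : Ideal (RepRing K Q))),
        ∀ r x, (Φ r x : RepRing K Q) = r * linearizationMap K C (delta x)) := by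
  have hmul := marks_prod_linearizationMap_mul_mem_range (K := K) hconn hfiber
  have horth := orthogonalIdempotents_delta hacyclic hmul
  refine ⟨⟨horth, ?_⟩, fun hC => ?_⟩
  · have hl (X Y : C.FullSubcategory) : linearizationMap K C (.single X 1) *
        linearizationMap K C (.single Y 1) ∈ (linearizationMap K C).range :=
      (hmul X Y).imp fun _ => congrArg Prod.snd
    rw [← funext (linearizationMap_single (K := K) (C := C))]
    simpa only [deltaBasis_apply] using exists_basis_closure_range_single hl
      (linearizationMap_injective hindec hiso) (deltaBasis hacyclic)
  · have ht := isTerminalBase C hC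
    have := finite_of_isTerminal ht
    have := Fintype.ofFinite C.FullSubcategory
    have hsum : ∑ x, linearizationMap K C (delta x) = 1 := by
      rw [← map_sum, sum_delta_of_isTerminal hacyclic ht, linearizationMap_single,
        RepRing.of_linearization_id]
    exact ⟨ringEquivPiSpan ⟨horth, hsum⟩, fun _ _ => rfl⟩
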